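/- All rings are commutative with unity and all modules are unital. Let $R$ be a ring. A finitely generated ideal $J$ of $R$ is a \emph{GV-ideal} if the natural map $R\to \operatorname{Hom}_R(J,R)$, $r\mapsto (j\mapsto rj)$, is an isomorphism. An $R$-module $M$ is \emph{GV-torsion-free} if no nonzero element of $M$ is annihilated by a GV-ideal; it is a \emph{$w$-module} if moreover $\operatorname{Ext}^1_R(R/J,M)=0$ for every GV-ideal $J$. A \emph{$w$-ideal} is an ideal of $R$ that is a $w$-module, and a \emph{maximal $w$-ideal} is an ideal maximal among the proper $w$-ideals (such ideals are prime). $R$ is a \emph{DW-ring} if every ideal of $R$ is a $w$-ideal. A sequence $0\to A\to B\to C\to 0$ of $R$-modules is \emph{$w$-exact} if $0\to A_{\mathfrak p}\to B_{\mathfrak p}\to C_{\mathfrak p}\to 0$ is exact for every maximal $w$-ideal $\mathfrak p$; a $w$-exact sequence is \emph{$w$-pure exact} if $0\to A\otimes_R M\to B\otimes_R M\to C\otimes_R M\to 0$ is $w$-exact for every $R$-module $M$. An $R$-module $A$ is \emph{absolutely pure} (resp. \emph{absolutely $w$-pure}) if for every $R$-module $B$ containing $A$ as a submodule the sequence $0\to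 A\to B\to B/A\to 0$ is pure exact (resp. $w$-pure exact), where pure exact means that it remains exact after tensoring with any $R$-module. An $R$-module $M$ is \emph{FP-projective} (resp. \emph{$w$-FP-projective}) if $\operatorname{Ext}^1_R(M,A)=0$ for every absolutely pure (resp. absolutely $w$-pure) $R$-module $A$. Then the following conditions are equivalent: \begin{enumerate} \item Every finitely presented $R$-module is $w$-FP-projective. \item Every FP-projective $R$-module is $w$-FP-projective. \item $R$ is a DW-ring. \end{enumerate} -/

import Mathlib

open CategoryTheory TensorProduct

universe u

/-- `J` is a Glaz-Vasconcelos ideal: it is finitely generated and the natural homomorphism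
`R → Hom_R(J, R)`, `r ↦ (j ↦ r * j)`, is an isomorphism. -/
def IsGVIdeal {R : Type u} [CommRing R] (J : Ideal R) : Prop :=
  J.FG ∧ Function.Bijective (LinearMap.toSpanSingleton R (J →ₗ[R] R) (Submodule.subtype J))

/-- `Ext¹_R(M, N) = 0`. -/
def ExtOneVanishes (R : Type u) [CommRing R] (M N : Type u) [AddCommGroup M] [Module R M]
    [AddCommGroup N] [Module R N] : Prop :=
  Subsingleton (Abelian.Ext.{u} (ModuleCat.of R M) (ModuleCat.of R N) 1)

/-- The only element of `M` that is annihilated by some GV-ideal is zero. -/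
def IsGVTorsionFree (R : Type u) [CommRing R] (M : Type u) [AddCommGroup M] [Module R M] : Prop :=
  ∀ x : M, (∃ J : Ideal R, IsGVIdeal J ∧ ∀ j ∈ J, j • x = 0) → x = 0

/-- A `w`-module: a GV-torsion-free module `M` with `Ext¹_R(R/J, M) = 0` for all GV-ideals `J`. -/
def IsWModule (R : Type u) [CommRing R] (M : Type u) [AddCommGroup M] [Module R M] : Prop :=
  IsGVTorsionFree R M ∧ ∀ J : Ideal R, IsGVIdeal J → ExtOneVanishes R (R ⧸ J) M

/-- A `w`-ideal: an ideal that is a `w`-module. -/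
def IsWIdeal {R : Type u} [CommRing R] (I : Ideal R) : Prop :=
  IsWModule R I

/-- A DW-ring: every ideal is a `w`-ideal. -/
def IsDWRing (R : Type u) [CommRing R] : Prop :=
  ∀ I : Ideal R, IsWIdeal I

/-- A maximal `w`-ideal: an ideal that is maximal among the proper `w`-ideals. -/
def IsMaximalWIdeal {R : Type u} [CommRing R] (p : Ideal R) : Prop :=
  Maximal (fun I : Ideal R => I ≠ ⊤ ∧ IsWIdeal I) p

/-- The sequence `0 → A → B → C → 0` is exact. -/
def IsShortExactSeq {R : Type u} [CommRing R] {A B C : Type u}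
    [AddCommGroup A] [Module R A] [AddCommGroup B] [Module R B] [AddCommGroup C] [Module R C]
    (f : A →ₗ[R] B) (g : B →ₗ[R] C) : Prop :=
  Function.Injective f ∧ Function.Exact f g ∧ Function.Surjective g

/-- The sequence `0 → A → B → C → 0` is `w`-exact: its localization at every maximal `w`-ideal
is exact. (Maximal `w`-ideals are always prime, so the primality instance, which is there only
to speak of the localization, excludes none of them.) -/
def IsWExactSeq {R : Type u} [CommRing R] {A B C : Type u}
    [AddCommGroup A] [Module R A] [AddCommGroup B] [Module R B] [AddCommGroup C] [Module R C]
    (f : A →ₗ[R] B) (g : B →ₗ[R] C) : Prop :=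
  ∀ (p : Ideal R) [p.IsPrime], IsMaximalWIdeal p →
    IsShortExactSeq (LocalizedModule.map p.primeCompl f) (LocalizedModule.map p.primeCompl g)

/-- The exact sequence `0 → A → B → C → 0` is pure exact: it stays exact after tensoring with
any module. -/
def IsPureExactSeq {R : Type u} [CommRing R] {A B C : Type u}
    [AddCommGroup A] [Module R A] [AddCommGroup B] [Module R B] [AddCommGroup C] [Module R C]
    (f : A →ₗ[R] B) (g : B →ₗ[R] C) : Prop :=
  IsShortExactSeq f g ∧
    ∀ (M : Type u) [AddCommGroup M] [Module R M],
      IsShortExactSeq (LinearMap.rTensor M f) (LinearMap.rTensor M g)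

/-- The `w`-exact sequence `0 → A → B → C → 0` is `w`-pure exact: it stays `w`-exact after
tensoring with any module. -/
def IsWPureExactSeq {R : Type u} [CommRing R] {A B C : Type u}
    [AddCommGroup A] [Module R A] [AddCommGroup B] [Module R B] [AddCommGroup C] [Module R C]
    (f : A →ₗ[R] B) (g : B →ₗ[R] C) : Prop :=
  IsWExactSeq f g ∧
    ∀ (M : Type u) [AddCommGroup M] [Module R M],
      IsWExactSeq (LinearMap.rTensor M f) (LinearMap.rTensor M g)

/-- `A` is absolutely pure: it is a pure submodule of every module that contains it. -/
def IsAbsolutelyPure (R : Type u) [CommRing R] (A : Type u) [AddCommGroup A] [Module R A] : Prop :=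
  ∀ (B : Type u) [AddCommGroup B] [Module R B] (f : A →ₗ[R] B), Function.Injective f →
    IsPureExactSeq f (LinearMap.range f).mkQ

/-- `A` is absolutely `w`-pure: it is a `w`-pure submodule of every module that contains it. -/
def IsAbsolutelyWPure (R : Type u) [CommRing R] (A : Type u) [AddCommGroup A] [Module R A] :
    Prop :=
  ∀ (B : Type u) [AddCommGroup B] [Module R B] (f : A →ₗ[R] B), Function.Injective f →
    IsWPureExactSeq f (LinearMap.range f).mkQ

/-- `M` is FP-projective: `Ext¹_R(M, A) = 0` for every absolutely pure module `A`. -/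
def IsFPProjective (R : Type u) [CommRing R] (M : Type u) [AddCommGroup M] [Module R M] : Prop :=
  ∀ (A : Type u) [AddCommGroup A] [Module R A], IsAbsolutelyPure R A → ExtOneVanishes R M A

/-- `M` is `w`-FP-projective: `Ext¹_R(M, A) = 0` for every absolutely `w`-pure module `A`. -/
def IsWFPProjective (R : Type u) [CommRing R] (M : Type u) [AddCommGroup M] [Module R M] : Prop :=
  ∀ (A : Type u) [AddCommGroup A] [Module R A], IsAbsolutelyWPure R A → ExtOneVanishes R M A

/-! The pivot is that DW follows once `R` is its own only GV-ideal. For a GV-ideal `J`, the module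
`J/J²` is killed by `J`, hence absolutely `w`-pure: no maximal `w`-ideal contains `J`, so its tensor
products vanish locally. If the finitely presented module `R/J` is `w`-FP-projective, the projection
`J → J/J²` is `j ↦ j • x`, which is zero. So `J = J²`, and Nakayama together with the GV property
forces `J = R`. Over a DW-ring every maximal ideal is a maximal `w`-ideal, so `w`-purity is purity
by the local-global principle. Finally, finitely presented modules are FP-projective because their
maps lift along pure quotients. -/

section ExtOne

variable {R : Type u} [CommRing R]

/-- If `Ext¹(R/J, N) = 0` then every linear map `J → N` is given by an element of `N`. -/
lemma ExtOneVanishes.exists_eq_smul {J : Ideal R} {N : Type u} [AddCommGroup N] [Module R N]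
    (h : ExtOneVanishes R (R ⧸ J) N) (g : J →ₗ[R] N) :
    ∃ x : N, ∀ j : J, g j = (j : R) • x := by
  let S : ShortComplex (ModuleCat.{u} R) :=
    ShortComplex.mk (ModuleCat.ofHom J.subtype) (ModuleCat.ofHom (Submodule.mkQ J))
      (by ext x; exact (Submodule.Quotient.mk_eq_zero J).mpr x.2)
  have hS : S.ShortExact := ModuleCat.shortComplex_shortExact S
    (LinearMap.exact_subtype_mkQ J) J.injective_subtype J.mkQ_surjective
  have : Subsingleton (Abelian.Ext.{u} S.X₃ (ModuleCat.of R N) 1) := h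
  obtain ⟨y, hy⟩ := Abelian.Ext.contravariant_sequence_exact₁ hS (ModuleCat.of R N)
    (Abelian.Ext.mk₀ (ModuleCat.ofHom g)) (n₁ := 1) rfl (Subsingleton.elim _ _)
  obtain ⟨k, rfl⟩ := Abelian.Ext.homEquiv₀.symm.surjective y
  rw [Abelian.Ext.homEquiv₀_symm_apply, Abelian.Ext.mk₀_comp_mk₀] at hy
  have hk := (Abelian.Ext.mk₀_bijective _ _).1 hy
  refine ⟨k.hom (1 : R), fun j => ?_⟩
  have h1 : k.hom (j : R) = g j := congrArg (fun φ => φ.hom j) hk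
  rw [← h1, ← map_smul]
  simp

/-- `Ext¹(M, A) = 0` as soon as all maps from `M` to cokernels of extensions of `A` lift. -/
lemma extOneVanishes_of_forall_lift {M A : Type u} [AddCommGroup M] [Module R M]
    [AddCommGroup A] [Module R A]
    (h : ∀ (E : Type u) [AddCommGroup E] [Module R E] (f : A →ₗ[R] E), Function.Injective f →
      ∀ φ : M →ₗ[R] E ⧸ LinearMap.range f,
        ∃ ψ : M →ₗ[R] E, (LinearMap.range f).mkQ ∘ₗ ψ = φ) :
    ExtOneVanishes R M A := by
  have := ModuleCat.enoughInjectives.{u, u} R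
  obtain ⟨I, _, f, _⟩ := EnoughInjectives.presentation (ModuleCat.of R A)
  have hf : Function.Injective f.hom := (ModuleCat.mono_iff_injective f).mp ‹_›
  let S : ShortComplex (ModuleCat.{u} R) :=
    ModuleCat.shortComplexOfCompEqZero _ _ f.hom.exact_map_mkQ_range.linearMap_comp_eq_zero
  have hS := ModuleCat.shortComplex_shortExact S
    f.hom.exact_map_mkQ_range hf (Submodule.mkQ_surjective _)
  have : Injective S.X₂ := ‹Injective I›
  refine subsingleton_of_forall_eq 0 fun x => ?_
  -- Since `I` is injective, every class is the connecting image of a map `M → I/A`; it vanishes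
  -- once that map lifts to `I`.
  obtain ⟨y, rfl⟩ := Abelian.Ext.covariant_sequence_exact₁ (ModuleCat.of R M) hS x
    (Abelian.Ext.eq_zero_of_injective _) (n₀ := 0) rfl
  obtain ⟨k, rfl⟩ := Abelian.Ext.homEquiv₀.symm.surjective y
  obtain ⟨ψ, hψ⟩ := h I f.hom hf k.hom
  have hk : k = ModuleCat.ofHom ψ ≫ S.g := by
    ext m
    exact (LinearMap.congr_fun hψ m).symm
  rw [Abelian.Ext.homEquiv₀_symm_apply, hk, ← Abelian.Ext.mk₀_comp_mk₀,
    Abelian.Ext.comp_assoc_of_second_deg_zero, hS.comp_extClass, Abelian.Ext.comp_zero]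

end ExtOne

section Purity

variable {R : Type u} [CommRing R] {A E : Type u} [AddCommGroup A] [Module R A]
  [AddCommGroup E] [Module R E]

/-- A finite linear system with constants in a pure submodule that has a solution in the ambient
module has one in the submodule. -/
lemma exists_solution_of_rTensor_injective (f : A →ₗ[R] E)
    (hf : ∀ (N : Type u) [AddCommGroup N] [Module R N],
      Function.Injective (LinearMap.rTensor N f))
    {m n : ℕ} (r : Fin m → Fin n → R) (x : Fin n → E) (a : Fin m → A)
    (h : ∀ i, f (a i) = ∑ j, r i j • x j) :
    ∃ y : Fin n → A, ∀ i, a i = ∑ j, r i j • y j := by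
  -- Test purity on the cokernel of the coefficient matrix: there the `x j` drop out of `∑ i, v i ⊗
  -- f (a i)`.
  let K : Submodule R (Fin m → R) := Submodule.span R (Set.range fun j i => r i j)
  let v : Fin m → (Fin m → R) ⧸ K := fun i => K.mkQ (Pi.single i 1)
  have hsum (c : Fin m → R) : ∑ i, c i • v i = K.mkQ c := by
    simp only [v, ← map_smul, ← map_sum]
    congr 1
    ext i
    simp [Finset.sum_apply, Pi.single_apply]
  have hv : Submodule.span R (Set.range v) = ⊤ := by
    refine eq_top_iff.mpr fun z _ => ?_
    obtain ⟨c, rfl⟩ := K.mkQ_surjective z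
    rw [← hsum]
    exact Submodule.sum_mem _ fun i _ =>
      Submodule.smul_mem _ _ (Submodule.subset_span ⟨i, rfl⟩)
  have hcol (j : Fin n) : ∑ i, r i j • v i = 0 := by
    rw [hsum fun i => r i j]
    exact (Submodule.Quotient.mk_eq_zero K).mpr (Submodule.subset_span ⟨j, rfl⟩)
  have hzero : ∑ i, v i ⊗ₜ[R] a i = 0 := by
    apply (f.lTensor_inj_iff_rTensor_inj _).mpr (hf ((Fin m → R) ⧸ K))
    simp only [map_sum, LinearMap.lTensor_tmul, h, map_zero, TensorProduct.tmul_sum,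
      TensorProduct.tmul_smul]
    rw [Finset.sum_comm]
    simp only [TensorProduct.smul_tmul', ← TensorProduct.sum_tmul, hcol,
      TensorProduct.zero_tmul, Finset.sum_const_zero]
  -- By the equational criterion, `a` is a combination of elements of `A` whose coefficient vectors
  -- lie in the column span `K`.
  obtain ⟨k, b, y, hay, hb⟩ :=
    TensorProduct.vanishesTrivially_of_sum_tmul_eq_zero R hv hzero
  have hbK (l : Fin k) : ∃ c : Fin n → R, ∑ j, c j • (fun i => r i j) = fun i => b i l := by
    rw [← Submodule.mem_span_range_iff_exists_fun, ← Submodule.Quotient.mk_eq_zero]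
    exact (hsum fun i => b i l).symm.trans (hb l)
  choose c hc using hbK
  refine ⟨fun j => ∑ l, c l j • y l, fun i => ?_⟩
  have hbc (l : Fin k) : b i l = ∑ j, c l j * r i j := by
    simpa using (congrFun (hc l) i).symm
  simp only [hay, hbc, Finset.smul_sum, Finset.sum_smul, smul_smul]
  rw [Finset.sum_comm]
  simp only [mul_comm]

lemma LinearMap.exists_comp_eq_of_ker_le {P M N : Type*} [AddCommGroup P] [Module R P]
    [AddCommGroup M] [Module R M] [AddCommGroup N] [Module R N] (p : P →ₗ[R] M)
    (hp : Function.Surjective p) (q : P →ₗ[R] N) (h : LinearMap.ker p ≤ LinearMap.ker q) :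
    ∃ ψ : M →ₗ[R] N, ψ ∘ₗ p = q := by
  let e := p.quotKerEquivOfSurjective hp
  refine ⟨(LinearMap.ker p).liftQ q h ∘ₗ e.symm.toLinearMap, LinearMap.ext fun x => ?_⟩
  have he : e.symm (p x) = (LinearMap.ker p).mkQ x := by
    rw [LinearEquiv.symm_apply_eq, Submodule.mkQ_apply]
    exact (p.quotKerEquivOfSurjective_apply_mk hp x).symm
  simp [he]

/-- Maps from finitely presented modules lift along cokernels of pure monomorphisms. -/
lemma Module.FinitePresentation.exists_lift_of_rTensor_injective {M : Type u} [AddCommGroup M]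
    [Module R M] [Module.FinitePresentation R M] (f : A →ₗ[R] E)
    (hf : ∀ (N : Type u) [AddCommGroup N] [Module R N],
      Function.Injective (LinearMap.rTensor N f))
    (φ : M →ₗ[R] E ⧸ LinearMap.range f) :
    ∃ ψ : M →ₗ[R] E, (LinearMap.range f).mkQ ∘ₗ ψ = φ := by
  obtain ⟨n, m, p, g, hp, hgp⟩ := Module.FinitePresentation.exists_fin' R M
  choose x hx using fun j : Fin n =>
    (LinearMap.range f).mkQ_surjective (φ (p (Pi.single j 1)))
  have hpφ : (LinearMap.range f).mkQ ∘ₗ Fintype.linearCombination R x = φ ∘ₗ p := by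
    ext j
    simpa [Fintype.linearCombination_apply_single] using hx j
  have hmem (i : Fin m) :
      Fintype.linearCombination R x (g (Pi.single i 1)) ∈ LinearMap.range f := by
    rw [← Submodule.Quotient.mk_eq_zero]
    refine (LinearMap.congr_fun hpφ _).trans ?_
    simp [hgp.apply_apply_eq_zero]
  choose a ha using hmem
  obtain ⟨y, hy⟩ := exists_solution_of_rTensor_injective f hf
    (fun i => g (Pi.single i 1)) x a fun i => by rw [ha, Fintype.linearCombination_apply]
  -- Arbitrary lifts `x j` violate the relations by elements of `A`; the solution `y` in `A`
  -- corrects them without changing their classes.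
  let q : (Fin n → R) →ₗ[R] E := Fintype.linearCombination R fun j => x j - f (y j)
  have hqg : q ∘ₗ g = 0 := by
    ext i
    have := ha i
    rw [hy i, Fintype.linearCombination_apply] at this
    simp [q, Fintype.linearCombination_apply, smul_sub, Finset.sum_sub_distrib, ← this]
  have hker : LinearMap.ker p ≤ LinearMap.ker q := by
    rw [hgp.linearMap_ker_eq]
    exact LinearMap.range_le_ker_iff.mpr hqg
  obtain ⟨ψ, hψ⟩ := p.exists_comp_eq_of_ker_le hp q hker
  refine ⟨ψ, (LinearMap.cancel_right hp).mp ?_⟩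
  rw [LinearMap.comp_assoc, hψ, ← hpφ]
  ext j
  have hfy : (LinearMap.range f).mkQ (f (y j)) = 0 :=
    (Submodule.Quotient.mk_eq_zero _).mpr ⟨_, rfl⟩
  simp only [q, LinearMap.comp_apply, LinearMap.single_apply,
    Fintype.linearCombination_apply_single, one_smul, map_sub, hfy, sub_zero]

lemma Module.FinitePresentation.isFPProjective (M : Type u) [AddCommGroup M] [Module R M]
    [Module.FinitePresentation R M] : IsFPProjective R M := by
  intro A _ _ hA
  refine extOneVanishes_of_forall_lift fun E _ _ f hf φ => ?_
  exact Module.FinitePresentation.exists_lift_of_rTensor_injective f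
    (fun N _ _ => ((hA E f hf).2 N).1) φ

end Purity

section GV

variable {R : Type u} [CommRing R]

lemma IsGVIdeal.eq_of_forall_mul_eq {J : Ideal R} (hJ : IsGVIdeal J) {r s : R}
    (h : ∀ j ∈ J, r * j = s * j) : r = s := by
  apply hJ.2.1
  ext ⟨j, hj⟩
  simpa using h j hj

/-- Vanishing of `Ext¹(R/J, I)` makes the inclusion `J → I` multiplication by some `x ∈ I`, and the
GV property gives `x = 1`. -/
lemma IsWIdeal.not_le_of_isGVIdeal {I J : Ideal R} (hI : IsWIdeal I) (hne : I ≠ ⊤)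
    (hJ : IsGVIdeal J) : ¬ J ≤ I := by
  intro hle
  obtain ⟨x, hx⟩ := (hI.2 J hJ).exists_eq_smul (Submodule.inclusion hle)
  have h1 : (1 : R) = x := hJ.eq_of_forall_mul_eq fun j hj => by
    have := congrArg Subtype.val (hx ⟨j, hj⟩)
    simpa [mul_comm] using this
  exact hne ((Ideal.eq_top_iff_one I).mpr (h1 ▸ x.2))

/-- A module killed by a GV-ideal is absolutely `w`-pure. -/
lemma IsGVIdeal.isAbsolutelyWPure {J : Ideal R} (hJ : IsGVIdeal J) {A : Type u} [AddCommGroup A]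
    [Module R A] (hA : ∀ j ∈ J, ∀ a : A, j • a = 0) : IsAbsolutelyWPure R A := by
  intro B _ _ f hf
  refine ⟨fun p _ _ => ⟨LocalizedModule.map_injective _ _ hf,
    LocalizedModule.map_exact _ _ _ f.exact_map_mkQ_range,
    LocalizedModule.map_surjective _ _ (Submodule.mkQ_surjective _)⟩, fun M _ _ p _ hp => ⟨?_,
    LocalizedModule.map_exact _ _ _
      (rTensor_exact M f.exact_map_mkQ_range (Submodule.mkQ_surjective _)),
    LocalizedModule.map_surjective _ _
      (LinearMap.rTensor_surjective _ (Submodule.mkQ_surjective _))⟩⟩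
  obtain ⟨j, hjJ, hjp⟩ := Set.not_subset.mp (hp.1.2.not_le_of_isGVIdeal hp.1.1 hJ)
  have : Subsingleton (LocalizedModule p.primeCompl (A ⊗[R] M)) := by
    refine LocalizedModule.subsingleton_iff.mpr fun z => ⟨j, hjp, ?_⟩
    induction z with
    | zero => simp
    | tmul a m => rw [TensorProduct.smul_tmul', hA j hjJ, TensorProduct.zero_tmul]
    | add x y hx hy => rw [smul_add, hx, hy, add_zero]
  exact Function.injective_of_subsingleton _

lemma IsGVIdeal.eq_top_of_isWFPProjective {J : Ideal R} (hJ : IsGVIdeal J)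
    (h : IsWFPProjective R (R ⧸ J)) : J = ⊤ := by
  have hpure : IsAbsolutelyWPure R (J ⧸ (J • ⊤ : Submodule R J)) := by
    refine hJ.isAbsolutelyWPure fun j hj a => ?_
    obtain ⟨a, rfl⟩ := Submodule.mkQ_surjective _ a
    rw [← map_smul]
    exact (Submodule.Quotient.mk_eq_zero _).mpr (Submodule.smul_mem_smul hj trivial)
  obtain ⟨x, hx⟩ := (h _ hpure).exists_eq_smul (Submodule.mkQ _)
  obtain ⟨x, rfl⟩ := Submodule.mkQ_surjective _ x
  have hidem : J ≤ J • J := fun j hj => by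
    have hj' : (⟨j, hj⟩ : J) ∈ (J • ⊤ : Submodule R J) := by
      rw [← Submodule.Quotient.mk_eq_zero]
      refine (hx ⟨j, hj⟩).trans ?_
      rw [← map_smul]
      exact (Submodule.Quotient.mk_eq_zero _).mpr (Submodule.smul_mem_smul hj trivial)
    have := Submodule.mem_map_of_mem (f := J.subtype) hj'
    rwa [Submodule.map_smul'', Submodule.map_top, Submodule.range_subtype] at this
  -- Nakayama yields `r ∈ J` acting as the identity on `J`.
  obtain ⟨r, hr, hr'⟩ := Submodule.exists_mem_and_smul_eq_self_of_fg_of_le_smul J J hJ.1 hidem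
  have h1 : r = 1 := hJ.eq_of_forall_mul_eq fun j hj => by simpa using hr' j hj
  exact (Ideal.eq_top_iff_one J).mpr (h1 ▸ hr)

lemma isDWRing_of_forall_isGVIdeal_eq_top (h : ∀ J : Ideal R, IsGVIdeal J → J = ⊤) :
    IsDWRing R := by
  refine fun I => ⟨fun x ⟨J, hJ, hx⟩ => ?_, fun J hJ => ?_⟩
  · rw [← one_smul R x]
    exact hx 1 (h J hJ ▸ trivial)
  · obtain rfl := h J hJ
    have : Projective (ModuleCat.of R (R ⧸ (⊤ : Ideal R))) :=
      (ModuleCat.isZero_of_subsingleton _).projective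
    exact subsingleton_of_forall_eq 0 Abelian.Ext.eq_zero_of_projective

lemma IsDWRing.isMaximalWIdeal (hR : IsDWRing R) (p : Ideal R) [hp : p.IsMaximal] :
    IsMaximalWIdeal p :=
  ⟨⟨hp.ne_top, hR p⟩, fun _ hI hle => (hp.eq_of_le hI.1 hle).ge⟩

lemma IsDWRing.isAbsolutelyPure (hR : IsDWRing R) {A : Type u} [AddCommGroup A] [Module R A]
    (hA : IsAbsolutelyWPure R A) : IsAbsolutelyPure R A := fun B _ _ f hf =>
  ⟨⟨hf, f.exact_map_mkQ_range, Submodule.mkQ_surjective _⟩, fun M _ _ =>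
    ⟨injective_of_localized_maximal _ fun p _ => ((hA B f hf).2 M p (hR.isMaximalWIdeal p)).1,
      rTensor_exact M f.exact_map_mkQ_range (Submodule.mkQ_surjective _),
      LinearMap.rTensor_surjective _ (Submodule.mkQ_surjective _)⟩⟩

end GV

theorem mainTheorem1 (R : Type u) [CommRing R] :
    List.TFAE [
      ∀ (M : Type u) [AddCommGroup M] [Module R M],
        Module.FinitePresentation R M → IsWFPProjective R M,
      ∀ (M : Type u) [AddCommGroup M] [Module R M],
        IsFPProjective R M → IsWFPProjective R M,
      IsDWRing R] := by
  tfae_have 1 → 3 := fun h => isDWRing_of_forall_isGVIdeal_eq_top fun J hJ =>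
    hJ.eq_top_of_isWFPProjective <| h _ <|
      Module.finitePresentation_of_surjective J.mkQ J.mkQ_surjective ((Submodule.ker_mkQ J).symm ▸ hJ.1)
  tfae_have 3 → 2 := fun hR _ _ _ hM A _ _ hA => hM A (hR.isAbsolutelyPure hA)
  tfae_have 2 → 1 := fun h M _ _ _ => h M (Module.FinitePresentation.isFPProjective M)
  tfae_finish
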